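/- Let $\mathcal H$ be a separable complex Hilbert space. A propagator in $\mathcal H$ is a family of unitary operators $U(t,s)$, $t,s\in\mathbb R$, jointly strongly continuous in $(t,s)$ and satisfying $U(t,r)U(r,s)=U(t,s)$ for all $t,r,s$. Put $\mathcal K=L^2(\mathbb R,\mathcal H,dt)$. The quasi-energy operator $K$ of the propagator $U$ is the generator of the one-parameter group $e^{-i\sigma K}$, $\sigma\in\mathbb R$, in $\mathcal K$ given by $(e^{-i\sigma K}f)(t)=U(t,t-\sigma)f(t-\sigma)$. For a family $H(t)$, $t\in\mathbb R$, of self-adjoint operators in $\mathcal H$ let $\mathfrak H=\int^\oplus_{\mathbb R}H(t)\,dt$ be the operator in $\mathcal K$ with $(\mathfrak Hf)(t)=H(t)f(t)$, whose domain consists of all $f\in\mathcal K$ such that $f(t)\in\operatorname{Dom}H(t)$ for a.e. $t$ and $t\mapsto H(t)f(t)$ belongs to $\mathcal K$. Let $-i\partial_t$ be the operator in $\mathcal K$ whose domain consists of all $f\in\mathcal K$ that are absolutely continuous on every compact interval and whose a.e. derivative $f'$ belongs to $\mathcal K$. The propagator $U$ is called weakly associated to $H(t)$ if $-i\partial_t+\mathfrak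 H$, with domain $\operatorname{Dom}(-i\partial_t)\cap\operatorname{Dom}\mathfrak H$, is densely defined and closable and $K=\overline{-i\partial_t+\mathfrak H}$. **Corollary.** Let $H(t)$, $t\in\mathbb R$, be self-adjoint operators in $\mathcal H$ with time-independent domain $\operatorname{Dom}H(t)=D$, and let $U(t,s)$ be a propagator associated to $H(t)$ as a strong solution of the Schrödinger equation, that is: $U(t,s)D=D$ for all $t,s\in\mathbb R$, and for all $\psi\in D$ and $s\in\mathbb R$ the function $t\mapsto U(t,s)\psi$ is continuously differentiable in the norm of $\mathcal H$ and satisfies $i\partial_tU(t,s)\psi=H(t)U(t,s)\psi$ for all $t\in\mathbb R$. Then $U(t,s)$ is weakly associated to $H(t)$. -/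

import Mathlib

open MeasureTheory Filter Topology

noncomputable section

/-- A propagator in a complex Hilbert space: a family `U(t,s)`, `t, s ∈ ℝ`, of unitary operators,
jointly strongly continuous and satisfying the Chapman-Kolmogorov equality. -/
structure Propagator (E : Type*) [NormedAddCommGroup E] [InnerProductSpace ℂ E] where
  /-- the unitary operator `U(t,s)` -/
  op : ℝ → ℝ → (E ≃ₗᵢ[ℂ] E)
  strongly_continuous : ∀ ψ : E, Continuous fun p : ℝ × ℝ => op p.1 p.2 ψ
  chapman_kolmogorov : ∀ (t s r : ℝ) (ψ : E), op t r (op r s ψ) = op t s ψ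

/-- The usual association of a propagator `U` with a family `H(t)` of operators:
`U(t,s) (Dom H(s)) = Dom H(t)`, and `i ∂ₜ U(t,s) ψ = H(t) U(t,s) ψ` for all `ψ ∈ Dom H(s)` and
all `t`, i.e. `t ↦ U(t,s) ψ` has at every `t` the norm derivative `-i H(t) U(t,s) ψ`. -/
structure Propagator.IsStronglyAssociated {E : Type*} [NormedAddCommGroup E]
    [InnerProductSpace ℂ E] (U : Propagator E) (H : ℝ → E →ₗ.[ℂ] E) : Prop where
  image_domain : ∀ t s : ℝ, (U.op t s) '' ((H s).domain : Set E) = ((H t).domain : Set E)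
  schrodinger : ∀ (s : ℝ), ∀ ψ ∈ (H s).domain, ∀ (t : ℝ),
    ∃ h : U.op t s ψ ∈ (H t).domain,
      HasDerivAt (fun r : ℝ => U.op r s ψ) (-Complex.I • H t ⟨U.op t s ψ, h⟩) t

/-- The Hilbert space `𝒦 = L²(ℝ, E, dt)`. -/
abbrev TimeL2 (E : Type*) [NormedAddCommGroup E] : Type _ :=
  Lp E 2 (volume : Measure ℝ)

/-- A function on the line is absolutely continuous if it is so on every compact interval. -/
def LocallyAC {E : Type*} [NormedAddCommGroup E] (u : ℝ → E) : Prop :=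
  ∀ a b : ℝ, AbsolutelyContinuousOnInterval u a b

section Momentum

variable (E : Type*) [NormedAddCommGroup E] [InnerProductSpace ℂ E]

theorem LocallyAC.continuous {E : Type*} [NormedAddCommGroup E] {u : ℝ → E}
    (hu : LocallyAC u) : Continuous u := by
  rw [continuous_iff_continuousAt]
  intro x
  refine (hu (x - 1) (x + 1)).continuousOn.continuousAt ?_
  rw [Set.uIcc_of_le (by linarith)]
  exact Icc_mem_nhds (by linarith) (by linarith)

theorem LocallyAC.const_smul {E : Type*} [NormedAddCommGroup E] [NormedSpace ℂ E]
    {u : ℝ → E} (hu : LocallyAC u) (c : ℂ) : LocallyAC (fun t => c • u t) := by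
  intro a b
  have h := hu a b
  rw [absolutelyContinuousOnInterval_iff] at h ⊢
  intro ε hε
  obtain ⟨δ, hδ, h'⟩ := h (ε / (‖c‖ + 1)) (by positivity)
  refine ⟨δ, hδ, fun F hF hlt => ?_⟩
  have h1 := h' F hF hlt
  simp only [dist_smul₀]
  rw [← Finset.mul_sum]
  have hc : (0 : ℝ) < ‖c‖ + 1 := by positivity
  rw [lt_div_iff₀ hc] at h1
  have h2 : 0 ≤ ∑ i ∈ Finset.range F.1, dist (u (F.2 i).1) (u (F.2 i).2) :=
    Finset.sum_nonneg fun _ _ => dist_nonneg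
  nlinarith

/-- The graph of `-i ∂ₜ` in `L²(ℝ, E)`: pairs `(f, g)` such that `f` has an absolutely continuous
representative `u` which is differentiable almost everywhere with `-i u' = g`, i.e. `u' = i g`. -/
def momentumGraph : Submodule ℂ (TimeL2 E × TimeL2 E) where
  carrier := {p | ∃ u : ℝ → E, LocallyAC u ∧ p.1 =ᵐ[volume] u ∧
    ∀ᵐ t : ℝ, HasDerivAt u (Complex.I • (p.2 : ℝ → E) t) t}
  zero_mem' := by
    refine ⟨fun _ => 0, fun a b => ?_, Lp.coeFn_zero _ _ _, ?_⟩
    · rw [absolutelyContinuousOnInterval_iff]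
      exact fun ε hε => ⟨1, one_pos, fun F _ _ => by simpa using hε⟩
    · filter_upwards [Lp.coeFn_zero E 2 (volume : Measure ℝ)] with t ht
      simp only [Prod.snd_zero, ht, Pi.zero_apply, smul_zero]
      exact hasDerivAt_const t (0 : E)
  add_mem' := by
    rintro p q ⟨u, hu, hpu, hu'⟩ ⟨v, hv, hqv, hv'⟩
    refine ⟨u + v, fun a b => (hu a b).add (hv a b), ?_, ?_⟩
    · exact (Lp.coeFn_add p.1 q.1).trans (hpu.add hqv)
    · filter_upwards [hu', hv', Lp.coeFn_add p.2 q.2] with t h1 h2 h3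
      rw [Prod.snd_add, h3, Pi.add_apply, smul_add]
      exact h1.add h2
  smul_mem' := by
    rintro c p ⟨u, hu, hpu, hu'⟩
    refine ⟨fun t => c • u t, hu.const_smul c, ?_, ?_⟩
    · filter_upwards [Lp.coeFn_smul c p.1, hpu] with t h1 h2
      rw [Prod.smul_fst, h1, Pi.smul_apply, h2]
    · filter_upwards [hu', Lp.coeFn_smul c p.2] with t h1 h2
      rw [Prod.smul_snd, h2, Pi.smul_apply, smul_comm]
      exact h1.const_smul c

theorem momentumGraph_snd_eq_zero (p : TimeL2 E × TimeL2 E) (hp : p ∈ momentumGraph E)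
    (h0 : p.1 = 0) : p.2 = 0 := by
  obtain ⟨u, hu, hpu, hu'⟩ := hp
  have hz : u = fun _ => (0 : E) := by
    refine (hu.continuous.ae_eq_iff_eq volume continuous_const).1 (hpu.symm.trans ?_)
    rw [h0]
    exact Lp.coeFn_zero _ _ _
  subst hz
  rw [Lp.eq_zero_iff_ae_eq_zero]
  filter_upwards [hu'] with t ht
  have := ht.unique (hasDerivAt_const t (0 : E))
  exact (smul_eq_zero.1 this).resolve_left Complex.I_ne_zero

/-- The operator `-i ∂ₜ` in `L²(ℝ, E)`. -/
def momentum : TimeL2 E →ₗ.[ℂ] TimeL2 E := (momentumGraph E).toLinearPMap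

theorem momentum_graph : (momentum E).graph = momentumGraph E :=
  Submodule.toLinearPMap_graph_eq _ (momentumGraph_snd_eq_zero E)

end Momentum

section DirectIntegral

variable {E : Type*} [NormedAddCommGroup E] [InnerProductSpace ℂ E]

/-- The graph of the direct integral `∫^⊕ H(t) dt`: pairs `(f, g)` of square integrable functions
such that `f(t) ∈ Dom H(t)` and `H(t) f(t) = g(t)` for almost every `t`. -/
def directIntegralGraph (H : ℝ → E →ₗ.[ℂ] E) : Submodule ℂ (TimeL2 E × TimeL2 E) where
  carrier := {p | ∀ᵐ t : ℝ, ∃ h : (p.1 : ℝ → E) t ∈ (H t).domain,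
    H t ⟨(p.1 : ℝ → E) t, h⟩ = (p.2 : ℝ → E) t}
  zero_mem' := by
    filter_upwards [Lp.coeFn_zero E 2 (volume : Measure ℝ)] with t ht
    simp only [Prod.fst_zero, Prod.snd_zero, ht, Pi.zero_apply]
    exact ⟨zero_mem _, (H t).map_zero⟩
  add_mem' := by
    intro p q hp hq
    filter_upwards [hp, hq, Lp.coeFn_add p.1 q.1, Lp.coeFn_add p.2 q.2] with t h1 h2 h3 h4
    obtain ⟨m1, e1⟩ := h1
    obtain ⟨m2, e2⟩ := h2
    simp only [Prod.fst_add, Prod.snd_add, h3, h4, Pi.add_apply]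
    refine ⟨add_mem m1 m2, ?_⟩
    rw [← e1, ← e2]
    exact (H t).map_add ⟨_, m1⟩ ⟨_, m2⟩
  smul_mem' := by
    intro c p hp
    filter_upwards [hp, Lp.coeFn_smul c p.1, Lp.coeFn_smul c p.2] with t h1 h3 h4
    obtain ⟨m1, e1⟩ := h1
    simp only [Prod.smul_fst, Prod.smul_snd, h3, h4, Pi.smul_apply]
    refine ⟨Submodule.smul_mem _ c m1, ?_⟩
    rw [← e1]
    exact (H t).map_smul c ⟨_, m1⟩

theorem directIntegralGraph_snd_eq_zero (H : ℝ → E →ₗ.[ℂ] E) (p : TimeL2 E × TimeL2 E)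
    (hp : p ∈ directIntegralGraph H) (h0 : p.1 = 0) : p.2 = 0 := by
  rw [Lp.eq_zero_iff_ae_eq_zero]
  have h0' : (p.1 : ℝ → E) =ᵐ[volume] 0 := by
    rw [h0]
    exact Lp.coeFn_zero _ _ _
  filter_upwards [hp, h0'] with t h1 h2
  obtain ⟨m, e⟩ := h1
  have hz : (⟨(p.1 : ℝ → E) t, m⟩ : (H t).domain) = 0 := Subtype.ext h2
  rw [← e, hz]
  exact (H t).map_zero

/-- The direct integral `𝔥 = ∫^⊕ H(t) dt` in `L²(ℝ, E)`. -/
def directIntegral (H : ℝ → E →ₗ.[ℂ] E) : TimeL2 E →ₗ.[ℂ] TimeL2 E :=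
  (directIntegralGraph H).toLinearPMap

theorem directIntegral_graph (H : ℝ → E →ₗ.[ℂ] E) :
    (directIntegral H).graph = directIntegralGraph H :=
  Submodule.toLinearPMap_graph_eq _ (directIntegralGraph_snd_eq_zero H)

end DirectIntegral

namespace Propagator

variable {E : Type*} [NormedAddCommGroup E] [InnerProductSpace ℂ E]

theorem continuous_apply (U : Propagator E) (σ : ℝ) :
    Continuous fun p : ℝ × E => U.op p.1 (p.1 - σ) p.2 := by
  rw [continuous_iff_continuousAt]
  rintro ⟨t₀, x₀⟩
  rw [ContinuousAt, tendsto_iff_dist_tendsto_zero]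
  have hc : Continuous fun t : ℝ => U.op t (t - σ) x₀ :=
    (U.strongly_continuous x₀).comp (continuous_id.prodMk (continuous_id.sub continuous_const))
  have hlim : Tendsto (fun p : ℝ × E => dist p.2 x₀ +
      dist (U.op p.1 (p.1 - σ) x₀) (U.op t₀ (t₀ - σ) x₀)) (𝓝 (t₀, x₀)) (𝓝 0) := by
    have : Continuous fun p : ℝ × E => dist p.2 x₀ +
        dist (U.op p.1 (p.1 - σ) x₀) (U.op t₀ (t₀ - σ) x₀) := by
      have := hc.comp (continuous_fst : Continuous (Prod.fst : ℝ × E → ℝ))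
      exact (continuous_snd.dist continuous_const).add (this.dist continuous_const)
    simpa using this.tendsto (t₀, x₀)
  refine squeeze_zero (fun _ => dist_nonneg) (fun p => ?_) hlim
  refine (dist_triangle _ (U.op p.1 (p.1 - σ) x₀) _).trans ?_
  rw [LinearIsometryEquiv.dist_map]

theorem memLp_shift (U : Propagator E) (σ : ℝ) (f : TimeL2 E) :
    MemLp (fun t : ℝ => U.op t (t - σ) ((f : ℝ → E) (t - σ))) 2 volume := by
  have hf : MemLp (fun t : ℝ => (f : ℝ → E) (t - σ)) 2 volume :=
    (Lp.memLp f).comp_measurePreserving (measurePreserving_sub_right volume σ)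
  refine hf.congr_norm ?_ (ae_of_all _ fun t => ?_)
  · exact (U.continuous_apply σ).comp_aestronglyMeasurable
      (aestronglyMeasurable_id.prodMk hf.aestronglyMeasurable)
  · simp

/-- The one-parameter group `σ ↦ exp(-iσK)` in `L²(ℝ, E)`, acting by
`f ↦ (t ↦ U(t, t - σ) f(t - σ))`. -/
def evolution (U : Propagator E) (σ : ℝ) : TimeL2 E →ₗ[ℂ] TimeL2 E where
  toFun f := (U.memLp_shift σ f).toLp _
  map_add' f g := by
    rw [← MemLp.toLp_add]
    refine MemLp.toLp_congr _ _ ?_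
    filter_upwards [(measurePreserving_sub_right volume σ).quasiMeasurePreserving.ae
      (Lp.coeFn_add f g)] with t ht
    simp only [Pi.add_apply] at ht ⊢
    rw [ht, map_add]
  map_smul' c f := by
    rw [RingHom.id_apply, ← MemLp.toLp_const_smul]
    refine MemLp.toLp_congr _ _ ?_
    filter_upwards [(measurePreserving_sub_right volume σ).quasiMeasurePreserving.ae
      (Lp.coeFn_smul c f)] with t ht
    simp only [Pi.smul_apply] at ht ⊢
    rw [ht, map_smul]

/-- The graph of the quasi-energy operator: pairs `(f, g)` such that
`d/dσ exp(-iσK) f = -i g` at `σ = 0`, in the norm of `L²(ℝ, E)`. -/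
def quasiEnergyGraph (U : Propagator E) : Submodule ℂ (TimeL2 E × TimeL2 E) where
  carrier := {p | HasDerivAt (fun σ : ℝ => U.evolution σ p.1) (-Complex.I • p.2) 0}
  zero_mem' := by
    simp only [Set.mem_ofPred_eq, Prod.fst_zero, Prod.snd_zero, map_zero, smul_zero]
    exact hasDerivAt_const (0 : ℝ) (0 : TimeL2 E)
  add_mem' := by
    intro p q hp hq
    simp only [Set.mem_ofPred_eq, Prod.fst_add, Prod.snd_add, map_add, smul_add] at hp hq ⊢
    exact hp.add hq
  smul_mem' := by
    intro c p hp
    simp only [Set.mem_ofPred_eq, Prod.smul_fst, Prod.smul_snd, map_smul] at hp ⊢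
    rw [smul_comm]
    exact hp.const_smul c

theorem quasiEnergyGraph_snd_eq_zero (U : Propagator E) (p : TimeL2 E × TimeL2 E)
    (hp : p ∈ U.quasiEnergyGraph) (h0 : p.1 = 0) : p.2 = 0 := by
  have hp' : HasDerivAt (fun σ : ℝ => U.evolution σ p.1) (-Complex.I • p.2) 0 := hp
  simp only [h0, map_zero] at hp'
  have := hp'.unique (hasDerivAt_const (0 : ℝ) (0 : TimeL2 E))
  exact (smul_eq_zero.1 this).resolve_left (neg_ne_zero.2 Complex.I_ne_zero)

/-- The quasi-energy operator `K` of a propagator: the generator of the group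
`(exp(-iσK) f)(t) = U(t, t - σ) f(t - σ)` in `L²(ℝ, E)`. -/
def quasiEnergy (U : Propagator E) : TimeL2 E →ₗ.[ℂ] TimeL2 E :=
  U.quasiEnergyGraph.toLinearPMap

theorem quasiEnergy_graph (U : Propagator E) : U.quasiEnergy.graph = U.quasiEnergyGraph :=
  Submodule.toLinearPMap_graph_eq _ U.quasiEnergyGraph_snd_eq_zero

/-- A propagator is weakly associated to the family `H(t)` if the operator `-i ∂ₜ + 𝔥`, with domain
`Dom(-i ∂ₜ) ∩ Dom 𝔥`, is densely defined and closable and its closure is the quasi-energy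
operator. -/
def IsWeaklyAssociated (U : Propagator E) (H : ℝ → E →ₗ.[ℂ] E) : Prop :=
  Dense ((momentum E + directIntegral H).domain : Set (TimeL2 E)) ∧
    (momentum E + directIntegral H).IsClosable ∧
    U.quasiEnergy = (momentum E + directIntegral H).closure

end Propagator

end

/-! Write `A` for the sum of `-i∂ₜ` and the direct integral, and `K` for the quasi-energy operator.
Everything is tested against the vectors `φ(t) U(t,0) ψ` with `ψ ∈ D` and `φ` compactly supported of
class C¹. These span a dense subspace, because `U(t,0)` is unitary and `D` is dense.

Against such vectors the evolution group acts on the scalar function `⟨U(t,0) ψ, f(t)⟩` as a plain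
translation. Hence `K f = g` is equivalent to a weak identity (`mem_quasiEnergyGraph_iff`), which is
stable under limits, so `K` is closed. Integration by parts and the symmetry of `H(t)` give this
identity on the graph of `A` (`isWeakPair_of_mem_graph`). So `A ⊆ K`, and `A` is closable.

For the converse, the Schrödinger equation shows that `A` maps `φ U(·,0) ψ` to `-i φ' U(·,0) ψ`
(`test_mem_graph`). A vector orthogonal to the range of `A + i` therefore has coefficients
satisfying `m' = -m` weakly. These are multiples of `exp(-t)`, and square integrability makes them
vanish; thus `A + i` has dense range. Since `K` is symmetric, `‖(K + i) f‖² = ‖K f‖² + ‖f‖²`, so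
approximating `(K + i) f` from the range of `A + i` approximates `(f, K f)` in the graph of `A`. -/

/-! ### Strongly continuous unitary families acting fibrewise on L². -/

section PointwiseIsometry

variable {E : Type*} [NormedAddCommGroup E] [InnerProductSpace ℂ E]

/-- Isometries are equicontinuous, so strong continuity upgrades to joint continuity. This is what
makes `t ↦ B t (f t)` measurable. -/
theorem continuous_uncurry_of_isometry (B : ℝ → E ≃ₗᵢ[ℂ] E) (hB : ∀ ψ, Continuous fun t => B t ψ) :
    Continuous fun p : ℝ × E => B p.1 p.2 := by
  rw [continuous_iff_continuousAt]
  rintro ⟨t₀, x₀⟩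
  rw [ContinuousAt, tendsto_iff_dist_tendsto_zero]
  have hlim : Tendsto (fun p : ℝ × E => dist p.2 x₀ + dist (B p.1 x₀) (B t₀ x₀))
      (𝓝 (t₀, x₀)) (𝓝 0) := by
    have : Continuous fun p : ℝ × E => dist p.2 x₀ + dist (B p.1 x₀) (B t₀ x₀) :=
      (continuous_snd.dist continuous_const).add
        (((hB x₀).comp continuous_fst).dist continuous_const)
    simpa using this.tendsto (t₀, x₀)
  refine squeeze_zero (fun _ => dist_nonneg) (fun p => ?_) hlim
  refine (dist_triangle _ (B p.1 x₀) _).trans ?_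
  rw [LinearIsometryEquiv.dist_map]

theorem memLp_pointwiseIsometry (B : ℝ → E ≃ₗᵢ[ℂ] E) (hB : ∀ ψ, Continuous fun t => B t ψ) (f : TimeL2 E) :
    MemLp (fun t => B t ((f : ℝ → E) t)) 2 volume :=
  (Lp.memLp f).congr_norm ((continuous_uncurry_of_isometry B hB).comp_aestronglyMeasurable
      (aestronglyMeasurable_id.prodMk (Lp.aestronglyMeasurable f)))
    (ae_of_all _ fun t => by simp)

/-- Pointwise application of a strongly continuous family of unitary operators. -/
noncomputable def pointwiseIsometry (B : ℝ → E ≃ₗᵢ[ℂ] E) (hB : ∀ ψ, Continuous fun t => B t ψ) :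
    TimeL2 E →ₗᵢ[ℂ] TimeL2 E where
  toFun f := (memLp_pointwiseIsometry B hB f).toLp _
  map_add' f g := by
    rw [← MemLp.toLp_add]
    refine MemLp.toLp_congr _ _ ?_
    filter_upwards [Lp.coeFn_add f g] with t ht
    simp only [Pi.add_apply] at ht ⊢
    rw [ht, map_add]
  map_smul' c f := by
    rw [RingHom.id_apply, ← MemLp.toLp_const_smul]
    refine MemLp.toLp_congr _ _ ?_
    filter_upwards [Lp.coeFn_smul c f] with t ht
    simp only [Pi.smul_apply] at ht ⊢
    rw [ht, map_smul]
  norm_map' f := by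
    simp only [LinearMap.coe_mk, AddHom.coe_mk, Lp.norm_toLp]
    rw [Lp.norm_def]
    congr 1
    exact eLpNorm_congr_norm_ae (ae_of_all _ fun t => by simp)

theorem coeFn_pointwiseIsometry (B : ℝ → E ≃ₗᵢ[ℂ] E) (hB : ∀ ψ, Continuous fun t => B t ψ) (f : TimeL2 E) :
    (pointwiseIsometry B hB f : ℝ → E) =ᵐ[volume] fun t => B t ((f : ℝ → E) t) :=
  (memLp_pointwiseIsometry B hB f).coeFn_toLp

end PointwiseIsometry

theorem hasDerivAt_integral_shift {m : ℝ → ℂ} (hm : LocallyIntegrable m) {φ : ℝ → ℝ}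
    (hφ : ContDiff ℝ 1 φ) (hc : HasCompactSupport φ) (r : ℝ) :
    HasDerivAt (fun r : ℝ => ∫ t, φ (t + r) • m t) (∫ t, deriv φ (t + r) • m t) r := by
  -- The integral is the convolution of `m` with the reflected `φ`, evaluated at `-r`. The two sign
  -- changes cancel in the derivative.
  have hc' : HasCompactSupport (fun y => φ (-y)) := hc.comp_homeomorph (Homeomorph.neg ℝ)
  have h := hc'.hasDerivAt_convolution_right (ContinuousLinearMap.lsmul ℝ ℝ (E := ℂ)).flip hm
    (hφ.comp contDiff_neg) (-r)
  have h2 := h.scomp r (hasDerivAt_neg r)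
  have e (x : ℝ) : deriv (fun y => φ (-y)) x = -deriv φ (-x) := deriv_comp_neg φ x
  convert! h2 using 1
  · funext r
    simp only [convolution_def, Function.comp]
    refine integral_congr_ae (ae_of_all _ fun t => ?_)
    simp [add_comm]
  · simp only [convolution_def, e]
    rw [neg_one_smul, ← integral_neg]
    refine integral_congr_ae (ae_of_all _ fun t => ?_)
    simp [add_comm]

/-! ### The evolution group and its test vectors. -/

namespace Propagator

variable {E : Type*} [NormedAddCommGroup E] [InnerProductSpace ℂ E] (U : Propagator E)

theorem op_self (t : ℝ) (ψ : E) : U.op t t ψ = ψ :=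
  (U.op t t).injective (U.chapman_kolmogorov t t t ψ)

theorem continuous_op_left (s : ℝ) (ψ : E) : Continuous fun t => U.op t s ψ :=
  (U.strongly_continuous ψ).comp (by fun_prop : Continuous fun t : ℝ => (t, s))

theorem continuous_op_right (t : ℝ) (ψ : E) : Continuous fun s => U.op t s ψ :=
  (U.strongly_continuous ψ).comp (by fun_prop : Continuous fun s : ℝ => (t, s))

theorem coeFn_evolution (σ : ℝ) (f : TimeL2 E) :
    (U.evolution σ f : ℝ → E) =ᵐ[volume] fun t => U.op t (t - σ) ((f : ℝ → E) (t - σ)) :=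
  (U.memLp_shift σ f).coeFn_toLp

theorem evolution_zero (f : TimeL2 E) : U.evolution 0 f = f := by
  refine Lp.ext ?_
  filter_upwards [U.coeFn_evolution 0 f] with t ht
  rw [ht, sub_zero, op_self]

/-- Passing to the interaction picture `f ↦ U(0,t) f(t)` conjugates the group to translation on L².
Strong continuity and norm preservation are then inherited from translations. -/
theorem evolution_eq_translation (σ : ℝ) (f : TimeL2 E) : U.evolution σ f =
    pointwiseIsometry (fun t => U.op t 0) (U.continuous_op_left 0)
      (DomAddAct.mk (-σ) +ᵥ pointwiseIsometry (fun t => U.op 0 t) (U.continuous_op_right 0) f) := by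
  refine Lp.ext ?_
  have h1 := coeFn_pointwiseIsometry (fun t => U.op 0 t) (U.continuous_op_right 0) f
  set F := pointwiseIsometry (fun t => U.op 0 t) (U.continuous_op_right 0) f
  have h2 := DomAddAct.vadd_Lp_ae_eq (DomAddAct.mk (-σ)) F
  filter_upwards [U.coeFn_evolution σ f, coeFn_pointwiseIsometry (fun t => U.op t 0) (U.continuous_op_left 0)
    (DomAddAct.mk (-σ) +ᵥ F), h2,
    (measurePreserving_sub_right volume σ).quasiMeasurePreserving.ae h1] with t e1 e2 e3 e4
  have : -σ + t = t - σ := by ring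
  rw [e1, e2, e3]
  simp only [Equiv.symm_apply_apply, vadd_eq_add, this, e4, chapman_kolmogorov]

theorem continuous_evolution (f : TimeL2 E) : Continuous fun σ => U.evolution σ f := by
  simp only [evolution_eq_translation]
  refine (pointwiseIsometry _ _).continuous.comp ?_
  have : Fact ((2 : ENNReal) ≠ ⊤) := ⟨by simp⟩
  have hmk : Continuous fun σ : ℝ => DomAddAct.mk (-σ) :=
    DomAddAct.continuous_mk.comp continuous_neg
  exact hmk.vadd continuous_const

theorem norm_evolution (σ : ℝ) (f : TimeL2 E) : ‖U.evolution σ f‖ = ‖f‖ := by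
  rw [evolution_eq_translation, LinearIsometry.norm_map, DomAddAct.norm_vadd_Lp, LinearIsometry.norm_map]

/-- The matrix coefficient `⟨U(t,0) ψ, f(t)⟩`. -/
noncomputable def coeff (ψ : E) (f : TimeL2 E) (t : ℝ) : ℂ :=
  inner ℂ (U.op t 0 ψ) ((f : ℝ → E) t)

theorem memLp_coeff (ψ : E) (f : TimeL2 E) : MemLp (U.coeff ψ f) 2 volume :=
  (Lp.memLp f).of_le_mul (c := ‖ψ‖)
    ((U.continuous_op_left 0 ψ).aestronglyMeasurable.inner (Lp.aestronglyMeasurable f))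
    (ae_of_all _ fun t => by
      simpa [coeff] using norm_inner_le_norm (𝕜 := ℂ) (U.op t 0 ψ) ((f : ℝ → E) t))

theorem locallyIntegrable_coeff (ψ : E) (f : TimeL2 E) : LocallyIntegrable (U.coeff ψ f) :=
  (U.memLp_coeff ψ f).locallyIntegrable (by norm_num)

/-- By Chapman-Kolmogorov, `U(t,0) ψ = U(t,t-σ) U(t-σ,0) ψ`, and the common unitary drops out of the
inner product. -/
theorem coeff_evolution (ψ : E) (σ : ℝ) (f : TimeL2 E) :
    U.coeff ψ (U.evolution σ f) =ᵐ[volume] fun t => U.coeff ψ f (t - σ) := by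
  filter_upwards [U.coeFn_evolution σ f] with t ht
  rw [coeff, coeff, ht, ← U.chapman_kolmogorov t 0 (t - σ) ψ, LinearIsometryEquiv.inner_map_map]

theorem integral_smul_coeff_evolution (φ : ℝ → ℝ) (ψ : E) (σ : ℝ) (f : TimeL2 E) :
    ∫ t, φ t • U.coeff ψ (U.evolution σ f) t = ∫ t, φ (t + σ) • U.coeff ψ f t := by
  rw [← integral_sub_right_eq_self (fun t => φ (t + σ) • U.coeff ψ f t) σ]
  refine integral_congr_ae ?_
  filter_upwards [U.coeff_evolution ψ σ f] with t ht
  rw [ht, sub_add_cancel]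

theorem memLp_test {φ : ℝ → ℝ} (hφ : Continuous φ) (hc : HasCompactSupport φ) (ψ : E) :
    MemLp (fun t => φ t • U.op t 0 ψ) 2 volume :=
  (hφ.smul (U.continuous_op_left 0 ψ)).memLp_of_hasCompactSupport hc.smul_right

/-- The vector `t ↦ φ(t) U(t,0) ψ`. -/
noncomputable def test {φ : ℝ → ℝ} (hφ : Continuous φ) (hc : HasCompactSupport φ) (ψ : E) :
    TimeL2 E :=
  (U.memLp_test hφ hc ψ).toLp _

theorem coeFn_test {φ : ℝ → ℝ} (hφ : Continuous φ) (hc : HasCompactSupport φ) (ψ : E) :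
    (U.test hφ hc ψ : ℝ → E) =ᵐ[volume] fun t => φ t • U.op t 0 ψ :=
  MemLp.coeFn_toLp _

theorem inner_test {φ : ℝ → ℝ} (hφ : Continuous φ) (hc : HasCompactSupport φ) (ψ : E)
    (f : TimeL2 E) : inner ℂ (U.test hφ hc ψ) f = ∫ t, φ t • U.coeff ψ f t := by
  rw [L2.inner_def]
  refine integral_congr_ae ?_
  filter_upwards [U.coeFn_test hφ hc ψ] with t ht
  rw [ht, coeff, inner_smul_left_eq_smul]

end Propagator

/-! ### Integration by parts for absolutely continuous functions. -/

section AbsolutelyContinuous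

theorem LocallyAC.of_dist_le {X Y : Type*} [NormedAddCommGroup X] [NormedAddCommGroup Y]
    {u : ℝ → X} {v : ℝ → Y} (hu : LocallyAC u) (h : ∀ s t, dist (v s) (v t) ≤ dist (u s) (u t)) :
    LocallyAC v := by
  intro a b
  exact squeeze_zero (fun _ => Finset.sum_nonneg fun _ _ => dist_nonneg)
    (fun _ => Finset.sum_le_sum fun _ _ => h _ _) (hu a b)

theorem LocallyAC.inner {E : Type*} [NormedAddCommGroup E] [InnerProductSpace ℂ E] {u v : ℝ → E}
    (hu : LocallyAC u) (hv : LocallyAC v) : LocallyAC fun t => inner ℂ (u t) (v t) := by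
  intro a b
  obtain ⟨C, hC⟩ := (hu a b).exists_bound
  obtain ⟨D, hD⟩ := (hv a b).exists_bound
  have hf := hu a b
  have hg := hv a b
  unfold AbsolutelyContinuousOnInterval at hf hg
  refine squeeze_zero' (Eventually.of_forall fun _ => Finset.sum_nonneg fun _ _ => dist_nonneg) ?_
    (by simpa using (hg.const_mul C).add (hf.const_mul D))
  rw [eventually_inf_principal]
  filter_upwards with I hI
  simp only [Finset.mul_sum, ← Finset.sum_add_distrib]
  refine Finset.sum_le_sum fun i hi => ?_
  have hm := hI.1 i hi
  set x := (I.2 i).1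
  set y := (I.2 i).2
  -- The splitting behind the product rule: each increment is controlled by those of `u` and `v`,
  -- weighted by the bounds `C` and `D`.
  have e : Inner.inner ℂ (u x) (v x) - Inner.inner ℂ (u y) (v y) =
      Inner.inner ℂ (u x) (v x - v y) + Inner.inner ℂ (u x - u y) (v y) := by
    rw [inner_sub_right, inner_sub_left]; ring
  rw [dist_eq_norm, dist_eq_norm, dist_eq_norm, e]
  refine (norm_add_le _ _).trans (add_le_add ?_ ?_)
  · exact (norm_inner_le_norm _ _).trans (by gcongr; exact hC _ hm.1)
  · refine (norm_inner_le_norm _ _).trans ?_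
    rw [mul_comm]
    gcongr
    exact hD _ hm.2

theorem ContDiff.locallyAC {E : Type*} [NormedAddCommGroup E] [NormedSpace ℝ E] {u : ℝ → E}
    (hu : ContDiff ℝ 1 u) : LocallyAC u :=
  fun _ _ => hu.contDiffOn.absolutelyContinuousOnInterval

theorem LocallyAC.integral_deriv_eq_zero_real {F k : ℝ → ℝ} (hF : LocallyAC F)
    (hc : HasCompactSupport F) (hk : ∀ᵐ t, HasDerivAt F (k t) t) : ∫ t, k t = 0 := by
  have h1 : ∫ t, k t = ∫ t, deriv F t :=
    integral_congr_ae (hk.mono fun t ht => ht.deriv.symm)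
  obtain ⟨R, hR⟩ := hc.isCompact.isBounded.subset_ball (0 : ℝ)
  rw [Real.ball_eq_Ioo, zero_sub, zero_add] at hR
  have hz : ∀ x, x ∉ Set.Ioo (-R) R → F x = 0 := fun x hx =>
    image_eq_zero_of_notMem_tsupport fun h => hx (hR h)
  rw [h1, ← intervalIntegral.integral_eq_integral_of_support_subset (a := -R) (b := R)
    ((support_deriv_subset.trans hR).trans Set.Ioo_subset_Ioc_self), (hF _ _).integral_deriv_eq_sub,
    hz R (by simp), hz (-R) (by simp), sub_zero]

theorem LocallyAC.integral_deriv_eq_zero {F k : ℝ → ℂ} (hF : LocallyAC F)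
    (hc : HasCompactSupport F) (hk : ∀ᵐ t, HasDerivAt F (k t) t) (hki : Integrable k) :
    ∫ t, k t = 0 := by
  apply Complex.ext
  · have h := Complex.reCLM.integral_comp_comm hki
    have h' := LocallyAC.integral_deriv_eq_zero_real (F := fun t => (F t).re)
      (k := fun t => (k t).re) (hF.of_dist_le fun s t => ?_) (hc.comp_left Complex.zero_re)
      (hk.mono fun t ht => Complex.reCLM.hasFDerivAt.comp_hasDerivAt t ht)
    · exact h.symm.trans h'
    · rw [Real.dist_eq, dist_eq_norm, ← Complex.sub_re]
      exact Complex.abs_re_le_norm _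
  · have h := Complex.imCLM.integral_comp_comm hki
    have h' := LocallyAC.integral_deriv_eq_zero_real (F := fun t => (F t).im)
      (k := fun t => (k t).im) (hF.of_dist_le fun s t => ?_) (hc.comp_left Complex.zero_im)
      (hk.mono fun t ht => Complex.imCLM.hasFDerivAt.comp_hasDerivAt t ht)
    · exact h.symm.trans h'
    · rw [Real.dist_eq, dist_eq_norm, ← Complex.sub_im]
      exact Complex.abs_im_le_norm _

end AbsolutelyContinuous

/-! ### Weak characterisation, closedness and symmetry of the quasi-energy operator. -/

namespace Propagator

variable {E : Type*} [NormedAddCommGroup E] [InnerProductSpace ℂ E] (U : Propagator E)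

/-- Totality of the test vectors: varying `φ` kills each coefficient almost everywhere, and density
of `D` with separability of `E` then kills `f`. -/
theorem eq_zero_of_integral_smul_coeff [SecondCountableTopology E] {D : Submodule ℂ E}
    (hD : Dense (D : Set E)) {f : TimeL2 E}
    (h : ∀ ψ ∈ D, ∀ φ : ℝ → ℝ, ContDiff ℝ 1 φ → HasCompactSupport φ →
      ∫ t, φ t • U.coeff ψ f t = 0) : f = 0 := by
  have h1 : ∀ ψ ∈ D, ∀ᵐ t, U.coeff ψ f t = 0 := fun ψ hψ =>
    ae_eq_zero_of_integral_contDiff_smul_eq_zero (U.locallyIntegrable_coeff ψ f)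
      fun φ hφ hc => h ψ hψ φ (hφ.of_le (by exact_mod_cast le_top)) hc
  have h2 : (fun t => U.op 0 t ((f : ℝ → E) t)) =ᵐ[volume] 0 := by
    refine ae_eq_zero_of_forall_inner (𝕜 := ℂ) fun c => ?_
    obtain ⟨ψ, hψD, hψ⟩ := mem_closure_iff_seq_limit.1 (hD c)
    -- A sequence from `D` approximating `c` needs only countably many exceptional null sets.
    filter_upwards [ae_all_iff.2 fun n => h1 (ψ n) (hψD n)] with t ht
    have h3 : ∀ n, inner ℂ (ψ n) (U.op 0 t ((f : ℝ → E) t)) = 0 := fun n => by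
      rw [← LinearIsometryEquiv.inner_map_map (U.op t 0), U.chapman_kolmogorov, op_self]
      exact ht n
    refine tendsto_nhds_unique (hψ.inner tendsto_const_nhds) ?_
    simp only [h3, Pi.zero_apply]
    exact tendsto_const_nhds
  rw [Lp.eq_zero_iff_ae_eq_zero]
  filter_upwards [h2] with t ht
  exact (U.op 0 t).map_eq_zero_iff.1 ht

/-- The weak form of `K f = g`, tested against the vectors `φ(t) U(t,0) ψ`. -/
def IsWeakPair (D : Submodule ℂ E) (f g : TimeL2 E) : Prop :=
  ∀ ψ ∈ D, ∀ φ : ℝ → ℝ, ContDiff ℝ 1 φ → HasCompactSupport φ →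
    ∫ t, φ t • U.coeff ψ g t = Complex.I * ∫ t, deriv φ t • U.coeff ψ f t

theorem isClosed_isWeakPair (D : Submodule ℂ E) :
    IsClosed {p : TimeL2 E × TimeL2 E | U.IsWeakPair D p.1 p.2} := by
  simp only [IsWeakPair, Set.ofPred_forall]
  refine isClosed_iInter fun ψ => isClosed_iInter fun _ => isClosed_iInter fun φ =>
    isClosed_iInter fun hφ => isClosed_iInter fun hc => ?_
  simp only [← U.inner_test hφ.continuous hc, ← U.inner_test (hφ.continuous_deriv le_rfl) hc.deriv]
  exact isClosed_eq (by fun_prop) (by fun_prop)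

theorem isWeakPair_of_mem_quasiEnergyGraph (D : Submodule ℂ E) {p : TimeL2 E × TimeL2 E}
    (hp : p ∈ U.quasiEnergyGraph) : U.IsWeakPair D p.1 p.2 := by
  intro ψ _ φ hφ hc
  have hp' : HasDerivAt (fun σ : ℝ => U.evolution σ p.1) (-Complex.I • p.2) 0 := hp
  have h1 := ((innerSL ℂ (U.test hφ.continuous hc ψ)).restrictScalars ℝ).hasFDerivAt.comp_hasDerivAt
    0 hp'
  have h2 := hasDerivAt_integral_shift (U.locallyIntegrable_coeff ψ p.1) hφ hc 0
  simp only [← integral_smul_coeff_evolution, ← U.inner_test hφ.continuous hc] at h2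
  have h3 := h1.unique h2
  simp only [ContinuousLinearMap.coe_restrictScalars', innerSL_apply_apply, evolution_zero,
    inner_smul_right] at h3
  rw [U.inner_test] at h3
  rw [← h3, ← mul_assoc]
  simp

/-- The weak identity integrates to a Duhamel formula, which can be differentiated in norm at `0`.
Paired with any test vector, the difference of the two sides has zero derivative in `σ` and vanishes
at `σ = 0`. -/
theorem evolution_eq_of_isWeakPair [CompleteSpace E] [SecondCountableTopology E]
    {D : Submodule ℂ E} (hD : Dense (D : Set E)) {f g : TimeL2 E} (h : U.IsWeakPair D f g)
    (σ : ℝ) : U.evolution σ f = f + (-Complex.I) • ∫ r in (0 : ℝ)..σ, U.evolution r g := by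
  rw [← sub_eq_zero]
  refine U.eq_zero_of_integral_smul_coeff hD fun ψ hψ φ hφ hc => ?_
  rw [← U.inner_test hφ.continuous hc]
  set T := U.test hφ.continuous hc ψ with hT
  have hd : ∀ r : ℝ, HasDerivAt (fun r => inner ℂ T (U.evolution r f -
      (f + (-Complex.I) • ∫ s in (0 : ℝ)..r, U.evolution s g))) 0 r := by
    intro r
    have h1 := hasDerivAt_integral_shift (U.locallyIntegrable_coeff ψ f) hφ hc r
    -- Translates of `φ` are again admissible, so the weak identity holds along the whole orbit and
    -- not only at `0`.
    have hs : ContDiff ℝ 1 fun t => φ (t + r) := hφ.comp (contDiff_id.add contDiff_const)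
    have hsc : HasCompactSupport fun t => φ (t + r) :=
      hc.comp_homeomorph (Homeomorph.addRight r)
    have h2 := h ψ hψ _ hs hsc
    simp only [deriv_comp_add_const] at h2
    have h3 : ∫ t, deriv φ (t + r) • U.coeff ψ f t = -Complex.I * inner ℂ T (U.evolution r g) := by
      rw [hT, U.inner_test, integral_smul_coeff_evolution, h2, ← mul_assoc]
      simp
    rw [h3] at h1
    simp only [← integral_smul_coeff_evolution, ← U.inner_test hφ.continuous hc, ← hT] at h1
    have h4 : HasDerivAt (fun r => ∫ s in (0 : ℝ)..r, U.evolution s g) (U.evolution r g) r :=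
      (U.continuous_evolution g).integral_hasStrictDerivAt 0 r |>.hasDerivAt
    have h5 := ((innerSL ℂ T).restrictScalars ℝ).hasFDerivAt.comp_hasDerivAt r
      ((h4.const_smul (-Complex.I)).const_add f)
    convert! h1.sub h5 using 1
    · funext r
      simp [inner_sub_right]
    · simp [inner_smul_right]
  have hconst := is_const_of_deriv_eq_zero (fun r => (hd r).differentiableAt)
    (fun r => (hd r).deriv) σ 0
  simpa [evolution_zero] using hconst

theorem mem_quasiEnergyGraph_iff [CompleteSpace E] [SecondCountableTopology E]
    {D : Submodule ℂ E} (hD : Dense (D : Set E)) (p : TimeL2 E × TimeL2 E) :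
    p ∈ U.quasiEnergyGraph ↔ U.IsWeakPair D p.1 p.2 := by
  refine ⟨U.isWeakPair_of_mem_quasiEnergyGraph D, fun h => ?_⟩
  change HasDerivAt (fun σ : ℝ => U.evolution σ p.1) (-Complex.I • p.2) 0
  simp only [U.evolution_eq_of_isWeakPair hD h]
  have h4 : HasDerivAt (fun r => ∫ s in (0 : ℝ)..r, U.evolution s p.2) (U.evolution 0 p.2) 0 :=
    (U.continuous_evolution p.2).integral_hasStrictDerivAt 0 0 |>.hasDerivAt
  rw [evolution_zero] at h4
  exact (h4.const_smul (-Complex.I)).const_add p.1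

theorem quasiEnergy_isClosed [CompleteSpace E] [SecondCountableTopology E]
    {D : Submodule ℂ E} (hD : Dense (D : Set E)) : U.quasiEnergy.IsClosed := by
  rw [LinearPMap.IsClosed, quasiEnergy_graph]
  convert! U.isClosed_isWeakPair D using 1
  ext p
  exact U.mem_quasiEnergyGraph_iff hD p

/-- Differentiating the constant `‖exp(-iσK) f‖²` at `0` shows that `⟨f, K f⟩` is real, which is the
orthogonality needed for the Pythagorean identity below. -/
theorem re_inner_I_smul_eq_zero {p : TimeL2 E × TimeL2 E} (hp : p ∈ U.quasiEnergyGraph) :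
    (inner ℂ p.2 (Complex.I • p.1)).re = 0 := by
  have hp' : HasDerivAt (fun σ : ℝ => U.evolution σ p.1) (-Complex.I • p.2) 0 := hp
  have h1 := hp'.inner ℂ hp'
  have h2 : HasDerivAt (fun σ : ℝ => inner ℂ (U.evolution σ p.1) (U.evolution σ p.1)) 0 0 := by
    simp only [inner_self_eq_norm_sq_to_K, norm_evolution]
    exact hasDerivAt_const _ _
  have h3 := congrArg Complex.re (h1.unique h2)
  rw [evolution_zero, Complex.add_re, ← inner_conj_symm (-Complex.I • p.2) p.1, Complex.conj_re,
    inner_smul_right] at h3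
  have h4 : (inner ℂ p.2 p.1).im = -(inner ℂ p.1 p.2).im := by
    rw [← inner_conj_symm, Complex.conj_im]
  rw [inner_smul_right]
  simp at h3 ⊢
  linarith

theorem norm_sq_add_I_smul {p : TimeL2 E × TimeL2 E} (hp : p ∈ U.quasiEnergyGraph) :
    ‖p.2 + Complex.I • p.1‖ ^ 2 = ‖p.2‖ ^ 2 + ‖p.1‖ ^ 2 := by
  rw [norm_add_sq (𝕜 := ℂ), norm_smul, Complex.norm_I, one_mul]
  have := U.re_inner_I_smul_eq_zero hp
  simp [this]

end Propagator

/-- The witness is `θ(t) = ∫ η` over the window from `t - a` to `t`; it vanishes once the window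
misses the support of `η`. -/
theorem exists_contDiff_deriv_eq_sub_shift {η : ℝ → ℝ} (hη : Continuous η)
    (hc : HasCompactSupport η) (a : ℝ) :
    ∃ θ : ℝ → ℝ, ContDiff ℝ 1 θ ∧ HasCompactSupport θ ∧ ∀ t, HasDerivAt θ (η t - η (t - a)) t := by
  have hF : ∀ t, HasDerivAt (fun t => ∫ s in (0 : ℝ)..t, η s) (η t) t :=
    fun t => (hη.integral_hasStrictDerivAt 0 t).hasDerivAt
  have hd : ∀ t, HasDerivAt (fun t => ∫ s in (t - a)..t, η s) (η t - η (t - a)) t := by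
    intro t
    have h := (hF t).sub ((hF (t - a)).comp_sub_const t a)
    convert! h using 1
    funext t
    exact (intervalIntegral.integral_interval_sub_left (hη.intervalIntegrable _ _)
      (hη.intervalIntegrable _ _)).symm
  refine ⟨_, ?_, ?_, hd⟩
  · rw [contDiff_one_iff_deriv]
    refine ⟨fun t => (hd t).differentiableAt, ?_⟩
    rw [funext fun t => (hd t).deriv]
    fun_prop
  · obtain ⟨R, hR⟩ := hc.isCompact.isBounded.subset_closedBall (0 : ℝ)
    refine HasCompactSupport.intro (isCompact_closedBall (0 : ℝ) (R + |a|)) fun t ht => ?_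
    rw [intervalIntegral.integral_congr (g := fun _ => 0), intervalIntegral.integral_zero]
    intro x hx
    refine image_eq_zero_of_notMem_tsupport fun h => ht ?_
    have h1 := hR h
    rw [mem_closedBall_zero_iff, Real.norm_eq_abs] at h1 ⊢
    have h2 := Set.abs_sub_right_of_mem_uIcc hx
    rw [sub_sub_cancel] at h2
    calc |t| = |(t - x) + x| := by ring_nf
      _ ≤ |t - x| + |x| := abs_add_le _ _
      _ ≤ R + |a| := by linarith

/-! ### The sum operator: inclusion in the quasi-energy operator, and density of domain and range.
-/

namespace Propagator

variable {E : Type*} [NormedAddCommGroup E] [InnerProductSpace ℂ E] (U : Propagator E)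

theorem mem_graph_momentum_add_directIntegral {H : ℝ → E →ₗ.[ℂ] E}
    {p : TimeL2 E × TimeL2 E} : p ∈ (momentum E + directIntegral H).graph ↔
      ∃ g₁ g₂, (p.1, g₁) ∈ momentumGraph E ∧ (p.1, g₂) ∈ directIntegralGraph H ∧ p.2 = g₁ + g₂ := by
  rw [← momentum_graph, ← directIntegral_graph, LinearPMap.mem_graph_iff]
  simp only [LinearPMap.mem_graph_iff]
  constructor
  · rintro ⟨y, h1, h2⟩
    exact ⟨momentum E ⟨y, y.2.1⟩, directIntegral H ⟨y, y.2.2⟩, ⟨⟨y, y.2.1⟩, h1, rfl⟩,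
      ⟨⟨y, y.2.2⟩, h1, rfl⟩, h2.symm⟩
  · rintro ⟨_, _, ⟨⟨y, hy⟩, rfl, rfl⟩, ⟨⟨z, hz⟩, h, rfl⟩, h2⟩
    obtain rfl : z = p.1 := h
    exact ⟨⟨p.1, hy, hz⟩, rfl, h2.symm⟩

theorem integrable_smul_coeff {φ : ℝ → ℝ} (hφ : Continuous φ) (hc : HasCompactSupport φ) (ψ : E)
    (f : TimeL2 E) : Integrable fun t => φ t • U.coeff ψ f t := by
  refine (L2.integrable_inner (𝕜 := ℂ) (U.test hφ hc ψ) f).congr ?_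
  filter_upwards [U.coeFn_test hφ hc ψ] with t ht
  rw [ht, coeff, inner_smul_left_eq_smul]

variable {H : ℝ → E →ₗ.[ℂ] E} {D : Submodule ℂ E}

theorem isWeakPair_of_mem_graph [CompleteSpace E] (hH : ∀ t, IsSelfAdjoint (H t))
    (hD : ∀ t, (H t).domain = D) (hU : U.IsStronglyAssociated H)
    (hC1 : ∀ s : ℝ, ∀ ψ ∈ D, ContDiff ℝ 1 (fun t : ℝ => U.op t s ψ))
    {p : TimeL2 E × TimeL2 E} (hp : p ∈ (momentum E + directIntegral H).graph) :
    U.IsWeakPair D p.1 p.2 := by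
  obtain ⟨g₁, g₂, ⟨u, hu, hfu, hu'⟩, h2, hg⟩ := mem_graph_momentum_add_directIntegral.1 hp
  intro ψ hψ φ hφ hc
  have hF : LocallyAC fun t => inner ℂ (φ t • U.op t 0 ψ) (u t) :=
    ((hφ.smul (hC1 0 ψ hψ)).locallyAC).inner hu
  have hFc : HasCompactSupport fun t => inner ℂ (φ t • U.op t 0 ψ) (u t) :=
    hc.mono fun t ht h => ht (by simp [h])
  have hsum := Lp.coeFn_add g₁ g₂
  rw [← hg] at hsum
  have hd : ∀ᵐ t, HasDerivAt (fun t => inner ℂ (φ t • U.op t 0 ψ) (u t))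
      (Complex.I * (φ t • U.coeff ψ p.2 t) + deriv φ t • U.coeff ψ p.1 t) t := by
    filter_upwards [hfu, hu', h2, hsum] with t e1 e2 e3 e4
    obtain ⟨m, hm⟩ := e3
    obtain ⟨n, hn⟩ := hU.schrodinger 0 ψ (by rwa [hD]) t
    have hφ' := (hφ.differentiable one_ne_zero t).hasDerivAt
    have h := (hφ'.smul hn).inner ℂ e2
    convert! h using 1
    -- Symmetry of `H(t)` moves it from the solution `U(t,0) ψ` onto `f(t)`, where it produces the
    -- direct-integral part `g₂`.
    have hs : inner ℂ (H t ⟨U.op t 0 ψ, n⟩) ((p.1 : ℝ → E) t) =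
        inner ℂ (U.op t 0 ψ) ((g₂ : ℝ → E) t) := by
      have hadj := LinearPMap.adjoint_isFormalAdjoint (hH t).dense_domain
      rw [LinearPMap.isSelfAdjoint_def.1 (hH t)] at hadj
      rw [← hm]
      exact hadj ⟨_, n⟩ ⟨_, m⟩
    rw [coeff, coeff, e4, ← e1]
    simp only [Pi.add_apply, Pi.smul_apply', inner_add_right, inner_add_left, inner_smul_left_eq_smul,
      inner_smul_right, inner_smul_left, hs, Complex.real_smul]
    simp
    ring
  have hi1 := (U.integrable_smul_coeff hφ.continuous hc ψ p.2).const_mul Complex.I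
  have hi2 := U.integrable_smul_coeff (hφ.continuous_deriv le_rfl) hc.deriv ψ p.1
  have h0 := hF.integral_deriv_eq_zero hFc hd (hi1.add hi2)
  rw [integral_add hi1 hi2, integral_const_mul] at h0
  linear_combination (-Complex.I) * h0 + (∫ t, φ t • U.coeff ψ p.2 t) * Complex.I_sq

/-- The term of `-i∂ₜ` that differentiates `U(t,0) ψ` cancels against `H(t) U(t,0) ψ`, leaving only
the derivative of `φ`. -/
theorem test_mem_graph (hD : ∀ t, (H t).domain = D) (hU : U.IsStronglyAssociated H)
    (hC1 : ∀ s : ℝ, ∀ ψ ∈ D, ContDiff ℝ 1 (fun t : ℝ => U.op t s ψ)) {ψ : E} (hψ : ψ ∈ D)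
    {φ : ℝ → ℝ} (hφ : ContDiff ℝ 1 φ) (hc : HasCompactSupport φ) :
    (U.test hφ.continuous hc ψ,
      (-Complex.I) • U.test (hφ.continuous_deriv le_rfl) hc.deriv ψ) ∈
      (momentum E + directIntegral H).graph := by
  have hψ1 := hC1 0 ψ hψ
  have hd : ∀ t, HasDerivAt (fun t => U.op t 0 ψ) (deriv (fun t => U.op t 0 ψ) t) t :=
    fun t => (hψ1.differentiable one_ne_zero t).hasDerivAt
  have hdc : Continuous (deriv fun t => U.op t 0 ψ) := hψ1.continuous_deriv le_rfl
  set v := deriv fun t => U.op t 0 ψ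
  -- This is `φ(t) H(t) U(t,0) ψ`, written through the continuous derivative `v`; measurability and
  -- square integrability follow without any regularity of `t ↦ H(t)`.
  have hm : MemLp (fun t => φ t • (Complex.I • v t)) 2 volume :=
    (hφ.continuous.smul (hdc.const_smul Complex.I)).memLp_of_hasCompactSupport hc.smul_right
  have hcoe := hm.coeFn_toLp
  set g₂ : TimeL2 E := hm.toLp _
  rw [mem_graph_momentum_add_directIntegral]
  refine ⟨(-Complex.I) • U.test (hφ.continuous_deriv le_rfl) hc.deriv ψ - g₂, g₂, ?_, ?_, by simp⟩
  · refine ⟨fun t => φ t • U.op t 0 ψ, (hφ.smul hψ1).locallyAC,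
      U.coeFn_test hφ.continuous hc ψ, ?_⟩
    filter_upwards [hcoe, Lp.coeFn_sub
      ((-Complex.I) • U.test (hφ.continuous_deriv le_rfl) hc.deriv ψ) g₂,
      Lp.coeFn_smul (-Complex.I) (U.test (hφ.continuous_deriv le_rfl) hc.deriv ψ),
      U.coeFn_test (hφ.continuous_deriv le_rfl) hc.deriv ψ] with t e1 e2 e3 e4
    rw [e2, Pi.sub_apply, e1, e3, Pi.smul_apply, e4]
    convert! (hφ.differentiable one_ne_zero t).hasDerivAt.smul (hd t) using 1
    rw [smul_sub, smul_smul, smul_comm Complex.I (φ t), smul_smul Complex.I Complex.I]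
    simp [add_comm]
  · filter_upwards [hcoe, U.coeFn_test hφ.continuous hc ψ] with t e1 e2
    obtain ⟨n, hn⟩ := hU.schrodinger 0 ψ (by rwa [hD]) t
    have hv : v t = -Complex.I • H t ⟨U.op t 0 ψ, n⟩ := (hd t).unique hn
    have hmem : φ t • U.op t 0 ψ ∈ (H t).domain := by
      rw [← Complex.coe_smul]
      exact (H t).domain.smul_mem _ n
    simp only [e2]
    refine ⟨hmem, ?_⟩
    rw [e1, hv, smul_smul]
    have : (⟨φ t • U.op t 0 ψ, hmem⟩ : (H t).domain) = (φ t : ℂ) • ⟨U.op t 0 ψ, n⟩ :=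
      Subtype.ext (Complex.coe_smul _ _).symm
    rw [this, LinearPMap.map_smul, Complex.coe_smul]
    simp

/-- The hypothesis says weakly that `m' = -m` for `m = U.coeff ψ h`, so translating the test
function by `a` rescales its pairing with `m` by a power of `exp a`. The pairings stay bounded
because translation preserves the L² norm, and letting `a → -∞` forces them to vanish. -/
theorem integral_smul_coeff_eq_zero_of_deriv {ψ : E} {h : TimeL2 E}
    (hh : ∀ φ : ℝ → ℝ, ContDiff ℝ 1 φ → HasCompactSupport φ →
      ∫ t, deriv φ t • U.coeff ψ h t = ∫ t, φ t • U.coeff ψ h t)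
    {φ : ℝ → ℝ} (hφ : ContDiff ℝ 1 φ) (hc : HasCompactSupport φ) :
    ∫ t, φ t • U.coeff ψ h t = 0 := by
  have hexp : Continuous fun t : ℝ => Real.exp (-t) * φ t :=
    (Real.continuous_exp.comp continuous_neg).mul hφ.continuous
  set C := ‖U.test hφ.continuous hc ψ‖ * ‖h‖
  have hbound : ∀ a : ℝ, ‖∫ t, φ t • U.coeff ψ h t‖ ≤ Real.exp a * C := by
    intro a
    -- With `η(t) = exp(-t) φ(t)`, the function `χ = exp(t) θ(t)` satisfies `χ' - χ = φ - exp(a) φ(·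
    -- - a)`; testing the hypothesis with `χ` gives the scaling relation.
    obtain ⟨θ, hθ, hθc, hθd⟩ := exists_contDiff_deriv_eq_sub_shift hexp hc.mul_left a
    have hd : ∀ t, deriv (fun t => Real.exp t * θ t) t =
        Real.exp t * θ t + (φ t - Real.exp a * φ (t + -a)) := by
      intro t
      rw [((Real.hasDerivAt_exp t).fun_mul (hθd t)).deriv, mul_sub, ← mul_assoc, ← mul_assoc,
        ← Real.exp_add, ← Real.exp_add]
      have e1 : t + -t = 0 := by ring
      have e2 : t + -(t - a) = a := by ring
      rw [e1, e2, Real.exp_zero, one_mul, ← sub_eq_add_neg]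
    have h1 := hh (fun t => Real.exp t * θ t) (Real.contDiff_exp.mul hθ) hθc.mul_left
    have i1 : Integrable fun t => (Real.exp t * θ t) • U.coeff ψ h t :=
      U.integrable_smul_coeff (Real.continuous_exp.mul hθ.continuous) hθc.mul_left ψ h
    have i2 := U.integrable_smul_coeff hφ.continuous hc ψ h
    have i3 : Integrable fun t => (Real.exp a : ℂ) * φ (t + -a) • U.coeff ψ h t :=
      (U.integrable_smul_coeff (hφ.continuous.comp (continuous_add_const (-a)))
        (hc.comp_homeomorph (Homeomorph.addRight (-a))) ψ h).const_mul (Real.exp a : ℂ)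
    have h2 : ∫ t, deriv (fun t => Real.exp t * θ t) t • U.coeff ψ h t =
        (∫ t, (Real.exp t * θ t) • U.coeff ψ h t) + ((∫ t, φ t • U.coeff ψ h t) -
          (Real.exp a : ℂ) * ∫ t, φ (t + -a) • U.coeff ψ h t) := by
      rw [← integral_const_mul, ← integral_sub i2 i3, ← integral_add i1 (by exact i2.sub i3)]
      refine integral_congr_ae (ae_of_all _ fun t => ?_)
      simp only [hd, Complex.real_smul]
      push_cast
      ring
    rw [h1] at h2
    have h3 : ∫ t, φ t • U.coeff ψ h t =
        (Real.exp a : ℂ) * inner ℂ (U.test hφ.continuous hc ψ) (U.evolution (-a) h) := by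
      rw [U.inner_test, integral_smul_coeff_evolution]
      linear_combination -h2
    rw [h3, norm_mul, Complex.norm_real, Real.norm_of_nonneg (Real.exp_pos a).le]
    gcongr
    refine (norm_inner_le_norm _ _).trans ?_
    rw [norm_evolution]
  have hlim : Tendsto (fun a : ℝ => Real.exp a * C) atBot (𝓝 0) := by
    simpa using Real.tendsto_exp_atBot.mul_const C
  exact norm_le_zero_iff.1 (ge_of_tendsto' hlim hbound)

theorem dense_domain_momentum_add_directIntegral [CompleteSpace E] [SecondCountableTopology E]
    (hDd : Dense (D : Set E)) (hD : ∀ t, (H t).domain = D) (hU : U.IsStronglyAssociated H)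
    (hC1 : ∀ s : ℝ, ∀ ψ ∈ D, ContDiff ℝ 1 (fun t : ℝ => U.op t s ψ)) :
    Dense ((momentum E + directIntegral H).domain : Set (TimeL2 E)) := by
  rw [Submodule.dense_iff_topologicalClosure_eq_top, Submodule.topologicalClosure_eq_top_iff,
    Submodule.eq_bot_iff]
  intro h hh
  refine U.eq_zero_of_integral_smul_coeff hDd fun ψ hψ φ hφ hc => ?_
  rw [← U.inner_test hφ.continuous hc]
  exact hh _ (LinearPMap.mem_domain_of_mem_graph (U.test_mem_graph hD hU hC1 hψ hφ hc))

/-- `A + i` sends the test vector of `χ` to that of `-i χ' + i χ`, so orthogonality of `h` to the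
range is exactly the weak equation `m' = -m` for its coefficients. -/
theorem dense_range_momentum_add_directIntegral_add_I [CompleteSpace E]
    [SecondCountableTopology E] (hDd : Dense (D : Set E)) (hD : ∀ t, (H t).domain = D)
    (hU : U.IsStronglyAssociated H)
    (hC1 : ∀ s : ℝ, ∀ ψ ∈ D, ContDiff ℝ 1 (fun t : ℝ => U.op t s ψ)) :
    Dense (((momentum E + directIntegral H).graph.map
      (LinearMap.snd ℂ _ _ + Complex.I • LinearMap.fst ℂ _ _) : Submodule ℂ (TimeL2 E)) :
        Set (TimeL2 E)) := by
  rw [Submodule.dense_iff_topologicalClosure_eq_top, Submodule.topologicalClosure_eq_top_iff,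
    Submodule.eq_bot_iff]
  intro h hh
  refine U.eq_zero_of_integral_smul_coeff hDd fun ψ hψ φ hφ hc =>
    U.integral_smul_coeff_eq_zero_of_deriv (fun χ hχ hχc => ?_) hφ hc
  have h0 := hh _ (Submodule.mem_map_of_mem (U.test_mem_graph hD hU hC1 hψ hχ hχc))
  simp only [LinearMap.add_apply, LinearMap.snd_apply, LinearMap.smul_apply, LinearMap.fst_apply,
    inner_add_left, inner_smul_left, U.inner_test] at h0
  simp only [map_neg, Complex.conj_I, neg_neg] at h0
  refine mul_left_cancel₀ Complex.I_ne_zero ?_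
  linear_combination h0

theorem mem_closure_graph_of_mem_quasiEnergyGraph {A : TimeL2 E →ₗ.[ℂ] TimeL2 E}
    (hA : A.graph ≤ U.quasiEnergyGraph) (hdense : Dense ((A.graph.map
      (LinearMap.snd ℂ _ _ + Complex.I • LinearMap.fst ℂ _ _) : Submodule ℂ (TimeL2 E)) :
        Set (TimeL2 E))) {p : TimeL2 E × TimeL2 E} (hp : p ∈ U.quasiEnergyGraph) :
    p ∈ A.graph.topologicalClosure := by
  change p ∈ closure (A.graph : Set (TimeL2 E × TimeL2 E))
  rw [Metric.mem_closure_iff]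
  intro ε hε
  obtain ⟨_, ⟨q, hq, rfl⟩, hlt⟩ :=
    Metric.mem_closure_iff.1 (hdense (p.2 + Complex.I • p.1)) ε hε
  refine ⟨q, hq, ?_⟩
  -- Both components of `p - q` are bounded by the single quantity `‖(K + i)(p - q)‖`, which is
  -- below `ε`.
  have h := U.norm_sq_add_I_smul (sub_mem hp (hA hq))
  have e : (p - q).2 + Complex.I • (p - q).1 =
      (p.2 + Complex.I • p.1) - (q.2 + Complex.I • q.1) := by
    simp only [Prod.fst_sub, Prod.snd_sub, smul_sub]
    abel
  rw [e, ← dist_eq_norm] at h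
  have hlt' : dist (p.2 + Complex.I • p.1) (q.2 + Complex.I • q.1) < ε := hlt
  have hsq : dist (p.2 + Complex.I • p.1) (q.2 + Complex.I • q.1) ^ 2 < ε ^ 2 := by gcongr
  rw [dist_eq_norm, Prod.norm_def, max_lt_iff]
  constructor
  · exact lt_of_pow_lt_pow_left₀ 2 hε.le (by nlinarith [sq_nonneg ‖(p - q).2‖])
  · exact lt_of_pow_lt_pow_left₀ 2 hε.le (by nlinarith [sq_nonneg ‖(p - q).1‖])

end Propagator

theorem mainTheorem9 {E : Type*} [NormedAddCommGroup E] [InnerProductSpace ℂ E] [CompleteSpace E]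
    [TopologicalSpace.SeparableSpace E] (U : Propagator E) (H : ℝ → E →ₗ.[ℂ] E)
    (hH : ∀ t : ℝ, IsSelfAdjoint (H t))
    (D : Submodule ℂ E) (hD : ∀ t : ℝ, (H t).domain = D)
    (hU : U.IsStronglyAssociated H)
    (hC1 : ∀ s : ℝ, ∀ ψ ∈ D, ContDiff ℝ 1 (fun t : ℝ => U.op t s ψ)) :
    U.IsWeaklyAssociated H := by
  have : SecondCountableTopology E := UniformSpace.secondCountable_of_separable E
  have hDd : Dense (D : Set E) := hD 0 ▸ (hH 0).dense_domain
  have hle : (momentum E + directIntegral H).graph ≤ U.quasiEnergyGraph := fun p hp =>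
    (U.mem_quasiEnergyGraph_iff hDd p).2 (U.isWeakPair_of_mem_graph hH hD hU hC1 hp)
  have hcl : U.quasiEnergy.IsClosed := U.quasiEnergy_isClosed hDd
  have hAK : momentum E + directIntegral H ≤ U.quasiEnergy :=
    LinearPMap.le_of_le_graph (by rwa [U.quasiEnergy_graph])
  have hclosable := hcl.isClosable.leIsClosable hAK
  refine ⟨U.dense_domain_momentum_add_directIntegral hDd hD hU hC1, hclosable,
    LinearPMap.eq_of_eq_graph ?_⟩
  rw [← hclosable.graph_closure_eq_closure_graph]
  -- The first inclusion is the density argument; the second holds because `K` is a closed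
  -- extension.
  refine le_antisymm (fun p hp => ?_) (Submodule.topologicalClosure_minimal _
    (LinearPMap.le_graph_of_le hAK) hcl)
  rw [U.quasiEnergy_graph] at hp
  exact U.mem_closure_graph_of_mem_quasiEnergyGraph hle
    (U.dense_range_momentum_add_directIntegral_add_I hDd hD hU hC1) hp
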